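/- **Setting.** Let $(\Omega,\mathcal F,\mathbb P)$ be a probability space and $(\theta_t)_{t\in\mathbb R}$ a $\mathcal B(\mathbb R)\otimes\mathcal F$-measurable flow on $\Omega$ that preserves $\mathbb P$. Let $X$ be a compact metric space and let $\varphi$ be a random dynamical system on $X$ over $\theta$: a measurable map $\varphi:\mathbb R\times\Omega\times X\to X$, $(t,\omega,x)\mapsto\varphi(t,\omega)x$, such that $(t,x)\mapsto\varphi(t,\omega)x$ is continuous for every $\omega$, $\varphi(0,\omega)=\mathrm{id}_X$ and $\varphi(s+t,\omega)=\varphi(s,\theta_t\omega)\circ\varphi(t,\omega)$ for all $s,t\in\mathbb R$. A random open set is a map $\omega\mapsto U(\omega)$ into the open subsets of $X$ such that $\omega\mapsto \mathrm{dist}(x,X\setminus U(\omega))$ is measurable for each $x\in X$ (with $\mathrm{dist}(x,\emptyset)=\infty$). It is a *random pre-attractor* if there is a random variable $T(\omega)>0$ with $$\overline{\bigcup_{t\ge T(\omega)}\varphi(t,\theta_{-t}\omega)U(\theta_{-t}\omega)}\subset U(\omega)\qquad\text{for all }\omega .$$ It *determines* the random local attractor and the corresponding repeller $$A(\omega)=\bigcap_{T\ge0}\overline{\bigcup_{t\ge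 T}\varphi(t,\theta_{-t}\omega)U(\theta_{-t}\omega)},\qquad R(\omega)=X\setminus\{x:\varphi(t,\omega)x\in U(\theta_t\omega)\text{ for some }t\ge0\}.$$ A *random attractor–repeller pair* is a pair $(A,R)$ determined by some random pre-attractor $U$. The set $U$ is *forward invariant* if $\varphi(t,\omega)U(\omega)\subset U(\theta_t\omega)$ for all $\omega$ and all $t\ge0$. **Statement.** Let $(A,R)$ be a random attractor–repeller pair of $\varphi$. Then there are an $\mathcal F\otimes\mathcal B(X)$-measurable function $l:\Omega\times X\to\mathbb R$ and a set $\Omega_0\in\mathcal F$ with $\mathbb P(\Omega_0)=1$ and $\theta_t^{-1}\Omega_0=\Omega_0$ for all $t\in\mathbb R$, such that for every $\omega\in\Omega_0$: (i) $l(\omega,x)=0$ for all $x\in A(\omega)$, and $l(\omega,x)=1$ for all $x\in R(\omega)$; (ii) for all $x\in X\setminus(A(\omega)\cup R(\omega))$ and all $t>0$, $\;1>l(\omega,x)>l(\theta_t\omega,\varphi(t,\omega)x)>0$. If $(A,R)$ is determined by a forward invariant random pre-attractor, one can take $\Omega_0=\Omega$. -/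

import Mathlib

open MeasureTheory Set

namespace RandomDynamics

/-- A metric dynamical system with two-sided continuous time: a jointly measurable flow on
`Ω` which preserves the measure `P`. -/
structure MetricDynSys (Ω : Type*) [MeasurableSpace Ω] (P : Measure Ω) where
  shift : ℝ → Ω → Ω
  measurable_shift : Measurable fun p : ℝ × Ω => shift p.1 p.2
  shift_zero : ∀ ω, shift 0 ω = ω
  shift_add : ∀ s t ω, shift (s + t) ω = shift s (shift t ω)
  measurePreserving_shift : ∀ t, MeasurePreserving (shift t) P P

/-- A (continuous, two-sided) random dynamical system on `X` over the metric dynamical system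
`θ`: a jointly measurable cocycle `φ(t, ω) x`, continuous in `(t, x)` for every `ω`. -/
structure RDS {Ω : Type*} [MeasurableSpace Ω] {P : Measure Ω} (θ : MetricDynSys Ω P)
    (X : Type*) [TopologicalSpace X] [MeasurableSpace X] where
  cocycle : ℝ → Ω → X → X
  measurable_cocycle : Measurable fun p : ℝ × Ω × X => cocycle p.1 p.2.1 p.2.2
  continuous_cocycle : ∀ ω, Continuous fun p : ℝ × X => cocycle p.1 ω p.2
  cocycle_zero : ∀ ω x, cocycle 0 ω x = x
  cocycle_add : ∀ s t ω x,
    cocycle (s + t) ω x = cocycle s (θ.shift t ω) (cocycle t ω x)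

/-- A random closed set: a map into the closed subsets of `X` with `ω ↦ dist(x, D(ω))` measurable
for every `x`. The distance is extended-valued, `dist(x, ∅) = ∞`, as the empty set is allowed. -/
structure IsRandomClosedSet {Ω X : Type*} [MeasurableSpace Ω] [PseudoEMetricSpace X]
    (D : Ω → Set X) : Prop where
  isClosed : ∀ ω, IsClosed (D ω)
  measurable_infEDist : ∀ x, Measurable fun ω => Metric.infEDist x (D ω)

/-- A random open set: a map whose complement is a random closed set. -/
def IsRandomOpenSet {Ω X : Type*} [MeasurableSpace Ω] [PseudoEMetricSpace X]
    (U : Ω → Set X) : Prop :=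
  IsRandomClosedSet fun ω => (U ω)ᶜ

section

variable {Ω : Type*} [MeasurableSpace Ω] {P : Measure Ω} {θ : MetricDynSys Ω P}
  {X : Type*} [MetricSpace X] [MeasurableSpace X]

/-- The closure of the union over `t ≥ T` of `φ(t, θ₋ₜ ω) D(θ₋ₜ ω)`. -/
def pullbackTail (φ : RDS θ X) (D : Ω → Set X) (T : ℝ) (ω : Ω) : Set X :=
  closure (⋃ t ∈ Ici T, φ.cocycle t (θ.shift (-t) ω) '' D (θ.shift (-t) ω))

/-- The omega-limit set of `D`. -/
def omegaLimitSet (φ : RDS θ X) (D : Ω → Set X) (ω : Ω) : Set X :=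
  ⋂ T ∈ Ici (0 : ℝ), pullbackTail φ D T ω

/-- A random pre-attractor: a random open set that contains, for some positive random variable
`T(ω)`, the closure of the union over `t ≥ T(ω)` of its pull-back images. -/
def IsPreattractor (φ : RDS θ X) (U : Ω → Set X) : Prop :=
  IsRandomOpenSet U ∧
    ∃ T : Ω → ℝ, Measurable T ∧ (∀ ω, 0 < T ω) ∧ ∀ ω, pullbackTail φ U (T ω) ω ⊆ U ω

/-- The basin: the points whose forward orbit enters `U`. -/
def basin (φ : RDS θ X) (U : Ω → Set X) (ω : Ω) : Set X :=
  {x | ∃ t : ℝ, 0 ≤ t ∧ φ.cocycle t ω x ∈ U (θ.shift t ω)}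

/-- Forward invariance: `φ(t, ω) U(ω) ⊆ U(θₜ ω)` for all `t ≥ 0`. -/
def IsForwardInvariant (φ : RDS θ X) (U : Ω → Set X) : Prop :=
  ∀ t : ℝ, 0 ≤ t → ∀ ω, φ.cocycle t ω '' U ω ⊆ U (θ.shift t ω)

/-- The random pre-attractor `U` determines the attractor `A` (its omega-limit set) and the
repeller `R` (the complement of its basin). -/
structure Determines (φ : RDS θ X) (U A R : Ω → Set X) : Prop where
  preattractor : IsPreattractor φ U
  attractor_eq : ∀ ω, A ω = omegaLimitSet φ U ω
  repeller_eq : ∀ ω, R ω = (basin φ U ω)ᶜ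

/-- A random attractor-repeller pair. -/
def IsAttractorRepellerPair (φ : RDS θ X) (A R : Ω → Set X) : Prop :=
  ∃ U : Ω → Set X, Determines φ U A R

end

end RandomDynamics

/-! Let `τ(ω, x)` be the essential infimum of the times, negative ones included, at which the orbit
of `x` lies in `U`, and let `l` be the Gaussian distribution function at `τ`. Since `τ` drops by `t`
along the flow, `l` decreases strictly wherever `τ` is finite (`measureReal_translate_lt`). On `A`
the orbit is always in `U`, so `τ = -∞`; off `A` the visits are bounded below. At the other end, a
visit must force visits of positive measure at non-negative times (`VisitsPersist`). This is clear
for forward invariant `U`; otherwise Poincaré recurrence bounds `T` along the orbit at arbitrarily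
late times, for almost every `ω` (`measure_compl_recurrentSet`). Ignoring null sets of times makes
`l` measurable by Fubini, with no measurable projection. -/

namespace RandomDynamics

open Filter

/-! ### Half-lines of times and their mass -/

section RealLine

/-- The times up to which `S` has Lebesgue measure zero. -/
def nullBefore (S : Set ℝ) : Set ℝ := {t | volume (S ∩ Iio t) = 0}

lemma isLowerSet_nullBefore (S : Set ℝ) : IsLowerSet (nullBefore S) := fun _ _ hba ha =>
  measure_mono_null (inter_subset_inter_right S (Iio_subset_Iio hba)) ha

lemma measurableSet_nullBefore (S : Set ℝ) : MeasurableSet (nullBefore S) :=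
  (isLowerSet_nullBefore S).ordConnected.measurableSet

lemma mem_nullBefore_translate {S : Set ℝ} {s t : ℝ} :
    t ∈ nullBefore {u | u + s ∈ S} ↔ t + s ∈ nullBefore S := by
  have h : {u | u + s ∈ S} ∩ Iio t = (fun u => u + s) ⁻¹' (S ∩ Iio (t + s)) := by
    ext u; simp
  simp only [nullBefore, mem_ofPred_eq]
  rw [h, measure_preimage_add_right]

lemma nullBefore_empty : nullBefore ∅ = univ := by
  ext; simp [nullBefore]

lemma nullBefore_univ : nullBefore univ = ∅ := by
  ext; simp [nullBefore]

lemma exists_notMem_nullBefore {S : Set ℝ} (hS : volume S ≠ 0) : ∃ c, c ∉ nullBefore S := by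
  by_contra! h
  refine hS (measure_mono_null (t := ⋃ n : ℕ, S ∩ Iio (n : ℝ)) (fun x hx => ?_)
    (measure_iUnion_null fun n => h n))
  obtain ⟨n, hn⟩ := exists_nat_gt x
  exact mem_iUnion.2 ⟨n, hx, hn⟩

variable {γ : Measure ℝ} [IsProbabilityMeasure γ] [γ.IsOpenPosMeasure]

lemma measureReal_pos_of_isLowerSet {D : Set ℝ} (hD : IsLowerSet D) (hne : D.Nonempty) :
    0 < γ.real D := by
  obtain ⟨c, hc⟩ := hne
  refine lt_of_lt_of_le ?_ (measureReal_mono (hD.Iic_subset hc))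
  exact lt_of_lt_of_le (ENNReal.toReal_pos (isOpen_Iio.measure_pos γ nonempty_Iio).ne'
    (measure_ne_top _ _)) (measureReal_mono Iio_subset_Iic_self)

lemma measureReal_lt_of_isLowerSet {D E : Set ℝ} (hDE : D ⊆ E) {a b : ℝ} (hab : a < b)
    (hE : Ioo a b ⊆ E) (hD : Disjoint D (Ioo a b)) : γ.real D < γ.real E := by
  have h1 : γ.real D + γ.real (Ioo a b) ≤ γ.real E := by
    rw [← measureReal_union hD measurableSet_Ioo]
    exact measureReal_mono (union_subset hDE hE)
  have h2 : 0 < γ.real (Ioo a b) :=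
    ENNReal.toReal_pos (isOpen_Ioo.measure_pos γ (nonempty_Ioo.2 hab)).ne' (measure_ne_top _ _)
  linarith

lemma measureReal_lt_one_of_isLowerSet {D : Set ℝ} (hD : IsLowerSet D) {c : ℝ} (hc : c ∉ D) :
    γ.real D < 1 := by
  rw [← probReal_univ (μ := γ)]
  refine measureReal_lt_of_isLowerSet (subset_univ _) (lt_add_one c) (subset_univ _) ?_
  exact disjoint_left.2 fun x hx hxc => hc (hD hxc.1.le hx)

/-- `D` is a half-line with finite endpoint, and its translate misses the last interval of length
`s`, which `γ` charges. -/
lemma measureReal_translate_lt {D D' : Set ℝ} (hD : IsLowerSet D) (hne : D.Nonempty)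
    {c : ℝ} (hc : c ∉ D) {s : ℝ} (hs : 0 < s) (h : ∀ t, t ∈ D' ↔ t + s ∈ D) :
    γ.real D' < γ.real D := by
  have hbdd : BddAbove D := ⟨c, fun x hx => not_lt.1 fun hlt => hc (hD hlt.le hx)⟩
  refine measureReal_lt_of_isLowerSet (a := sSup D - s) (b := sSup D)
    (fun x hx => hD (by linarith) ((h x).1 hx)) (by linarith) (fun x hx => ?_) ?_
  · obtain ⟨d, hd, hxd⟩ := exists_lt_of_lt_csSup hne hx.2
    exact hD hxd.le hd
  · refine disjoint_left.2 fun x hx hxs => ?_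
    have := le_csSup hbdd ((h x).1 hx)
    linarith [hxs.1]

end RealLine

instance isOpenPosMeasure_gaussianReal :
    (ProbabilityTheory.gaussianReal 0 1).IsOpenPosMeasure :=
  (ProbabilityTheory.gaussianReal_absolutelyContinuous' 0 one_ne_zero).isOpenPosMeasure

section

variable {Ω : Type*} [MeasurableSpace Ω] {P : Measure Ω} {θ : MetricDynSys Ω P}
  {X : Type*} [MetricSpace X] [MeasurableSpace X]

/-! ### Visit times and the omega-limit set -/

lemma MetricDynSys.shift_neg_shift (θ : MetricDynSys Ω P) (t : ℝ) (ω : Ω) :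
    θ.shift (-t) (θ.shift t ω) = ω := by
  rw [← θ.shift_add, neg_add_cancel, θ.shift_zero]

/-- The times at which the orbit of `x` over `ω` lies in `U`. -/
def visitTimes (φ : RDS θ X) (U : Ω → Set X) (p : Ω × X) : Set ℝ :=
  {t | φ.cocycle t p.1 p.2 ∈ U (θ.shift t p.1)}

lemma visitTimes_shift (φ : RDS θ X) (U : Ω → Set X) (ω : Ω) (x : X) (s : ℝ) :
    visitTimes φ U (θ.shift s ω, φ.cocycle s ω x) = {t | t + s ∈ visitTimes φ U (ω, x)} := by
  ext t
  simp only [visitTimes, mem_ofPred_eq]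
  rw [φ.cocycle_add, θ.shift_add]

/-- Seen from time `t`, a visit at time `s` is a pull-back over the time `t - s`. -/
lemma mem_pullbackTail_of_mem_visitTimes (φ : RDS θ X) {U : Ω → Set X} {ω : Ω} {x : X}
    {s t T : ℝ} (hs : s ∈ visitTimes φ U (ω, x)) (hT : T ≤ t - s) :
    φ.cocycle t ω x ∈ pullbackTail φ U T (θ.shift t ω) := by
  refine subset_closure (mem_biUnion (mem_Ici.2 hT) ?_)
  have h1 : θ.shift (-(t - s)) (θ.shift t ω) = θ.shift s ω := by
    rw [← θ.shift_add]; congr 1; ring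
  rw [h1]
  refine ⟨_, hs, ?_⟩
  rw [← φ.cocycle_add, sub_add_cancel]

lemma exists_lowerBound_visitTimes (φ : RDS θ X) {U : Ω → Set X} {ω : Ω} {x : X}
    (hx : x ∉ omegaLimitSet φ U ω) : ∃ c, Disjoint (visitTimes φ U (ω, x)) (Iio c) := by
  simp only [omegaLimitSet, mem_iInter, not_forall] at hx
  obtain ⟨T, -, hxT⟩ := hx
  refine ⟨-T, disjoint_left.2 fun t ht htT => hxT ?_⟩
  have h := mem_pullbackTail_of_mem_visitTimes φ (t := 0) (T := T) ht
    (by have := mem_Iio.1 htT; linarith)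
  rwa [φ.cocycle_zero, θ.shift_zero] at h

lemma cocycle_mem_omegaLimitSet (φ : RDS θ X) {U : Ω → Set X} {ω : Ω} {x : X}
    (hx : x ∈ omegaLimitSet φ U ω) (s : ℝ) :
    φ.cocycle s ω x ∈ omegaLimitSet φ U (θ.shift s ω) := by
  simp only [omegaLimitSet, mem_iInter] at hx ⊢
  intro T _
  -- Pull-back time `t` over `ω` becomes `s + t` over `θ.shift s ω`. The maximum with `0` keeps the
  -- tail among those intersected, as `s` may have either sign.
  have hmaps : MapsTo (φ.cocycle s ω)
      (⋃ t ∈ Ici (max (T - s) 0), φ.cocycle t (θ.shift (-t) ω) '' U (θ.shift (-t) ω))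
      (⋃ t ∈ Ici T, φ.cocycle t (θ.shift (-t) (θ.shift s ω)) ''
        U (θ.shift (-t) (θ.shift s ω))) := by
    intro y hy
    simp only [mem_iUnion] at hy ⊢
    obtain ⟨t, ht, z, hz, rfl⟩ := hy
    have hts := (le_max_left _ _).trans (mem_Ici.1 ht)
    have h1 : θ.shift (-(s + t)) (θ.shift s ω) = θ.shift (-t) ω := by
      rw [← θ.shift_add]; congr 1; ring
    refine ⟨s + t, mem_Ici.2 (by linarith), ?_⟩
    rw [h1]
    refine ⟨z, hz, ?_⟩
    rw [φ.cocycle_add, ← θ.shift_add, add_neg_cancel, θ.shift_zero]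
  have hcont : Continuous (φ.cocycle s ω) :=
    (φ.continuous_cocycle ω).comp (Continuous.prodMk_right s)
  exact hmaps.closure hcont (hx _ (mem_Ici.2 (le_max_right _ _)))

lemma IsPreattractor.omegaLimitSet_subset {φ : RDS θ X} {U : Ω → Set X}
    (hU : IsPreattractor φ U) (ω : Ω) : omegaLimitSet φ U ω ⊆ U ω := by
  obtain ⟨-, T, -, hpos, hT⟩ := hU
  exact (biInter_subset_of_mem (mem_Ici.2 (hpos ω).le)).trans (hT ω)

lemma IsPreattractor.visitTimes_eq_univ {φ : RDS θ X} {U : Ω → Set X}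
    (hU : IsPreattractor φ U) {ω : Ω} {x : X} (hx : x ∈ omegaLimitSet φ U ω) :
    visitTimes φ U (ω, x) = univ :=
  eq_univ_of_forall fun t => hU.omegaLimitSet_subset _ (cocycle_mem_omegaLimitSet φ hx t)

/-! ### Persistence of visits and Poincaré recurrence -/

/-- Over `ω`, every orbit that visits `U` spends a set of non-negative times of positive measure
in `U`. -/
def VisitsPersist (φ : RDS θ X) (U : Ω → Set X) (ω : Ω) : Prop :=
  ∀ x, (visitTimes φ U (ω, x)).Nonempty → volume (visitTimes φ U (ω, x) ∩ Ici 0) ≠ 0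

lemma IsForwardInvariant.visitsPersist {φ : RDS θ X} {U : Ω → Set X}
    (hU : IsForwardInvariant φ U) (ω : Ω) : VisitsPersist φ U ω := by
  rintro x ⟨s, hs⟩ h0
  have hsub : Ici (max s 0) ⊆ visitTimes φ U (ω, x) ∩ Ici 0 := by
    intro t ht
    have hst : s ≤ t := (le_max_left _ _).trans ht
    refine ⟨?_, (le_max_right _ _).trans (mem_Ici.1 ht)⟩
    have h := hU (t - s) (by linarith) (θ.shift s ω) ⟨_, hs, rfl⟩
    rwa [← φ.cocycle_add, ← θ.shift_add, sub_add_cancel] at h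
  simpa using measure_mono_null hsub h0

/-- The points `ω` for which, for some bound `N`, the inequality `T (θₜ ω) ≤ N` keeps holding for
sets of arbitrarily large times of positive measure. -/
def recurrentSet (θ : MetricDynSys Ω P) (T : Ω → ℝ) : Set Ω :=
  {ω | ∃ N : ℕ, ∀ k : ℕ, volume ({t | T (θ.shift t ω) ≤ N} ∩ Ici (k : ℝ)) ≠ 0}

/-- After a visit at time `s`, the orbit is in `U` at every `t ≥ s + N` with `T (θ.shift t ω) ≤ N`.
-/
lemma visitsPersist_of_mem_recurrentSet {φ : RDS θ X} {U : Ω → Set X} {T : Ω → ℝ}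
    (hT : ∀ ω, pullbackTail φ U (T ω) ω ⊆ U ω) {ω : Ω} (hω : ω ∈ recurrentSet θ T) :
    VisitsPersist φ U ω := by
  rintro x ⟨s, hs⟩ h0
  obtain ⟨N, hN⟩ := hω
  obtain ⟨k, hk⟩ := exists_nat_ge (s + N)
  refine hN k (measure_mono_null (t := visitTimes φ U (ω, x) ∩ Ici 0)
    (fun t ht => ⟨hT _ ?_, ?_⟩) h0)
  · have h1 : T (θ.shift t ω) ≤ N := ht.1
    have h2 : (k : ℝ) ≤ t := ht.2
    exact mem_pullbackTail_of_mem_visitTimes φ hs (by linarith)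
  · exact (Nat.cast_nonneg k).trans (mem_Ici.1 ht.2)

lemma shift_mem_recurrentSet {T : Ω → ℝ} {ω : Ω} (hω : ω ∈ recurrentSet θ T) (s : ℝ) :
    θ.shift s ω ∈ recurrentSet θ T := by
  obtain ⟨N, hN⟩ := hω
  refine ⟨N, fun k h0 => ?_⟩
  obtain ⟨m, hm⟩ := exists_nat_ge (k + s)
  refine hN m (measure_mono_null (t := {t | T (θ.shift t ω) ≤ N} ∩ Ici (k + s))
    (inter_subset_inter_right _ (Ici_subset_Ici.2 hm)) ?_)
  rw [← measure_preimage_add_right volume s]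
  convert h0 using 2
  ext t
  simp [θ.shift_add]

lemma preimage_shift_recurrentSet (T : Ω → ℝ) (s : ℝ) :
    θ.shift s ⁻¹' recurrentSet θ T = recurrentSet θ T := by
  ext ω
  refine ⟨fun h => ?_, fun h => shift_mem_recurrentSet h s⟩
  have := shift_mem_recurrentSet (mem_preimage.1 h) (-s)
  rwa [θ.shift_neg_shift] at this

lemma measurable_volume_sublevel_inter (θ : MetricDynSys Ω P) {T : Ω → ℝ} (hT : Measurable T)
    (N : ℝ) {J : Set ℝ} (hJ : MeasurableSet J) :
    Measurable fun ω => volume ({t | T (θ.shift t ω) ≤ N} ∩ J) := by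
  have h : MeasurableSet {p : Ω × ℝ | T (θ.shift p.2 p.1) ≤ N ∧ p.2 ∈ J} :=
    (measurableSet_le (hT.comp (θ.measurable_shift.comp measurable_swap))
      measurable_const).inter (measurable_snd hJ)
  exact measurable_measure_prodMk_left h

lemma measurableSet_recurrentSet {T : Ω → ℝ} (hT : Measurable T) :
    MeasurableSet (recurrentSet θ T) := by
  have : recurrentSet θ T = ⋃ N : ℕ, ⋂ k : ℕ,
      {ω | volume ({t | T (θ.shift t ω) ≤ N} ∩ Ici (k : ℝ)) ≠ 0} := by
    ext; simp [recurrentSet]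
  rw [this]
  exact MeasurableSet.iUnion fun N => MeasurableSet.iInter fun k =>
    (measurable_volume_sublevel_inter θ hT N measurableSet_Ici)
      (measurableSet_singleton 0).compl

lemma exists_volume_sublevel_ne_zero (θ : MetricDynSys Ω P) (T : Ω → ℝ) (ω : Ω) :
    ∃ N : ℕ, volume ({t | T (θ.shift t ω) ≤ N} ∩ Icc 0 1) ≠ 0 := by
  by_contra! h
  have hsub : Icc (0 : ℝ) 1 ⊆ ⋃ N : ℕ, {t | T (θ.shift t ω) ≤ N} ∩ Icc 0 1 := by
    intro t ht
    obtain ⟨N, hN⟩ := exists_nat_ge (T (θ.shift t ω))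
    exact mem_iUnion.2 ⟨N, hN, ht⟩
  simpa using measure_mono_null hsub (measure_iUnion_null h)

lemma iterate_shift_one (θ : MetricDynSys Ω P) (n : ℕ) (ω : Ω) :
    (θ.shift 1)^[n] ω = θ.shift n ω := by
  induction n with
  | zero => simp [θ.shift_zero]
  | succ n ih =>
    rw [Function.iterate_succ_apply', ih, ← θ.shift_add]
    push_cast
    rw [add_comm]

/-- The sets `F N` cover `Ω` because `T` is finite. Recurrence of the time-one map to `F N` supplies
infinitely many unit windows `[n, n + 1]` in which `T ≤ N` on positive measure. -/
lemma measure_compl_recurrentSet [IsFiniteMeasure P] {T : Ω → ℝ} (hT : Measurable T) :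
    P (recurrentSet θ T)ᶜ = 0 := by
  let F : ℕ → Set Ω := fun N => {ω | volume ({t | T (θ.shift t ω) ≤ N} ∩ Icc 0 1) ≠ 0}
  have hF : ∀ N, MeasurableSet (F N) := fun N =>
    (measurable_volume_sublevel_inter θ hT N measurableSet_Icc) (measurableSet_singleton 0).compl
  have hae : ∀ᵐ ω ∂P, ∀ N, ω ∈ F N → ∃ᶠ n in atTop, (θ.shift 1)^[n] ω ∈ F N :=
    ae_all_iff.2 fun N => (θ.measurePreserving_shift 1).conservative.ae_mem_imp_frequently_image_mem
      (hF N).nullMeasurableSet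
  change ∀ᵐ ω ∂P, ω ∈ recurrentSet θ T
  filter_upwards [hae] with ω hω
  obtain ⟨N, hN⟩ := exists_volume_sublevel_ne_zero θ T ω
  refine ⟨N, fun k h0 => ?_⟩
  obtain ⟨n, hkn, hn⟩ := frequently_atTop.1 (hω N hN) k
  rw [iterate_shift_one] at hn
  refine hn ?_
  rw [← measure_preimage_add_right volume (n : ℝ)] at h0
  refine measure_mono_null (fun t ht => ?_) h0
  have hkn' : (k : ℝ) ≤ n := Nat.cast_le.2 hkn
  have ht1 : T (θ.shift t (θ.shift n ω)) ≤ N := ht.1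
  rw [← θ.shift_add] at ht1
  exact ⟨ht1, mem_Ici.2 (by linarith [ht.2.1])⟩

/-! ### The Lyapunov function -/

/-- The distance to the complement is continuous in `x` and measurable in `ω`, hence jointly
measurable. -/
lemma IsRandomOpenSet.measurableSet_graph [SecondCountableTopology X] [OpensMeasurableSpace X]
    {U : Ω → Set X} (hU : IsRandomOpenSet U) : MeasurableSet {p : Ω × X | p.2 ∈ U p.1} := by
  have hm : Measurable (Function.uncurry fun (x : X) (ω : Ω) => Metric.infEDist x (U ω)ᶜ) :=
    measurable_uncurry_of_continuous_of_measurable (fun _ => Metric.continuous_infEDist)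
      hU.measurable_infEDist
  have hset : {p : Ω × X | p.2 ∈ U p.1} =
      {p : Ω × X | Metric.infEDist p.2 (U p.1)ᶜ ≠ 0} := by
    ext p
    have := (Metric.mem_iff_infEDist_zero_of_closed (x := p.2) (hU.isClosed p.1))
    simp [← this]
  rw [hset]
  exact (hm.comp measurable_swap) (measurableSet_singleton 0).compl

/-- The measure of the set of times before which the orbit of `x` over `ω` spends no time in `U`,
that is, the value of the distribution function of `γ` at the (essential) entrance time to `U`. -/
noncomputable def entranceFunction (γ : Measure ℝ) (φ : RDS θ X) (U : Ω → Set X) (p : Ω × X) : ℝ :=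
  γ.real (nullBefore (visitTimes φ U p))

lemma measurable_entranceFunction (γ : Measure ℝ) [SFinite γ] (φ : RDS θ X) {U : Ω → Set X}
    (hU : MeasurableSet {p : Ω × X | p.2 ∈ U p.1}) : Measurable (entranceFunction γ φ U) := by
  have hmap : Measurable fun q : ((Ω × X) × ℝ) × ℝ =>
      (θ.shift q.2 q.1.1.1, φ.cocycle q.2 q.1.1.1 q.1.1.2) :=
    (θ.measurable_shift.comp (f := fun q : ((Ω × X) × ℝ) × ℝ => (q.2, q.1.1.1))
      (by fun_prop)).prodMk
    (φ.measurable_cocycle.comp (f := fun q : ((Ω × X) × ℝ) × ℝ => (q.2, q.1.1.1, q.1.1.2))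
      (by fun_prop))
  have h1 : MeasurableSet {q : ((Ω × X) × ℝ) × ℝ |
      φ.cocycle q.2 q.1.1.1 q.1.1.2 ∈ U (θ.shift q.2 q.1.1.1) ∧ q.2 < q.1.2} :=
    (hmap hU).inter (measurableSet_lt measurable_snd (measurable_snd.comp measurable_fst))
  have h2 : MeasurableSet {r : (Ω × X) × ℝ | r.2 ∈ nullBefore (visitTimes φ U r.1)} :=
    (measurable_measure_prodMk_left (ν := volume) h1) (measurableSet_singleton 0)
  exact (measurable_measure_prodMk_left (ν := γ) h2).ennreal_toReal

lemma Determines.entranceFunction_spec {γ : Measure ℝ} [IsProbabilityMeasure γ]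
    [γ.IsOpenPosMeasure] {φ : RDS θ X} {U A R : Ω → Set X} (h : Determines φ U A R) {ω : Ω}
    (hω : VisitsPersist φ U ω) :
    (∀ x ∈ A ω, entranceFunction γ φ U (ω, x) = 0) ∧
    (∀ x ∈ R ω, entranceFunction γ φ U (ω, x) = 1) ∧
    ∀ x ∉ A ω ∪ R ω, ∀ t : ℝ, 0 < t →
      entranceFunction γ φ U (ω, x) < 1 ∧
      entranceFunction γ φ U (θ.shift t ω, φ.cocycle t ω x) < entranceFunction γ φ U (ω, x) ∧
      0 < entranceFunction γ φ U (θ.shift t ω, φ.cocycle t ω x) := by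
  refine ⟨fun x hx => ?_, fun x hx => ?_, fun x hx t ht => ?_⟩
  · rw [h.attractor_eq] at hx
    rw [entranceFunction, h.preattractor.visitTimes_eq_univ hx, nullBefore_univ,
      measureReal_empty]
  · rw [h.repeller_eq] at hx
    have hempty : visitTimes φ U (ω, x) = ∅ := by
      -- Membership in `R` excludes only non-negative visit times; persistence excludes the negative
      -- ones too.
      by_contra hne
      obtain ⟨s, hs, hs0⟩ := nonempty_of_measure_ne_zero (hω x (nonempty_iff_ne_empty.2 hne))
      exact hx ⟨s, hs0, hs⟩
    rw [entranceFunction, hempty, nullBefore_empty, probReal_univ]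
  · rw [mem_union, not_or, h.attractor_eq, h.repeller_eq, notMem_compl_iff] at hx
    obtain ⟨hxA, s, -, hs⟩ := hx
    obtain ⟨c, hc⟩ := exists_lowerBound_visitTimes φ hxA
    have hcD : c ∈ nullBefore (visitTimes φ U (ω, x)) := by
      simp [nullBefore, hc.inter_eq]
    obtain ⟨d, hd⟩ := exists_notMem_nullBefore
      (fun h0 => hω x ⟨s, hs⟩ (measure_mono_null inter_subset_left h0))
    have htr : ∀ u, u ∈ nullBefore (visitTimes φ U (θ.shift t ω, φ.cocycle t ω x)) ↔
        u + t ∈ nullBefore (visitTimes φ U (ω, x)) := fun u => by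
      rw [visitTimes_shift, mem_nullBefore_translate]
    refine ⟨measureReal_lt_one_of_isLowerSet (isLowerSet_nullBefore _) hd,
      measureReal_translate_lt (isLowerSet_nullBefore _) ⟨c, hcD⟩ hd ht htr,
      measureReal_pos_of_isLowerSet (isLowerSet_nullBefore _) ⟨c - t, (htr _).2 ?_⟩⟩
    rwa [sub_add_cancel]

end

end RandomDynamics

theorem mainTheorem8 {Ω : Type*} [MeasurableSpace Ω] (P : Measure Ω) [IsProbabilityMeasure P]
    (θ : RandomDynamics.MetricDynSys Ω P)
    {X : Type*} [MetricSpace X] [CompactSpace X] [MeasurableSpace X] [BorelSpace X]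
    (φ : RandomDynamics.RDS θ X) (A R : Ω → Set X)
    (hAR : RandomDynamics.IsAttractorRepellerPair φ A R) :
    ∃ (Ω₀ : Set Ω) (l : Ω × X → ℝ),
      MeasurableSet Ω₀ ∧ P Ω₀ᶜ = 0 ∧ (∀ t, θ.shift t ⁻¹' Ω₀ = Ω₀) ∧
      ((∃ U, RandomDynamics.IsForwardInvariant φ U ∧ RandomDynamics.Determines φ U A R) →
        Ω₀ = univ) ∧
      Measurable l ∧
      ∀ ω ∈ Ω₀,
        (∀ x ∈ A ω, l (ω, x) = 0) ∧
        (∀ x ∈ R ω, l (ω, x) = 1) ∧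
        ∀ x ∉ A ω ∪ R ω, ∀ t : ℝ, 0 < t →
          l (ω, x) < 1 ∧
          l (θ.shift t ω, φ.cocycle t ω x) < l (ω, x) ∧
          0 < l (θ.shift t ω, φ.cocycle t ω x) := by
  let γ := ProbabilityTheory.gaussianReal 0 1
  have hmeas : ∀ {U}, RandomDynamics.IsPreattractor φ U →
      Measurable (RandomDynamics.entranceFunction γ φ U) := fun hU =>
    RandomDynamics.measurable_entranceFunction γ φ hU.1.measurableSet_graph
  -- Different pre-attractors may determine the same pair; a forward invariant one is chosen if
  -- there is any.
  by_cases hfwd : ∃ U, RandomDynamics.IsForwardInvariant φ U ∧ RandomDynamics.Determines φ U A R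
  · obtain ⟨U, hinv, hU⟩ := hfwd
    exact ⟨univ, RandomDynamics.entranceFunction γ φ U, MeasurableSet.univ, by simp,
      fun _ => preimage_univ, fun _ => rfl, hmeas hU.preattractor,
      fun ω _ => hU.entranceFunction_spec (hinv.visitsPersist ω)⟩
  · obtain ⟨U, hU⟩ := hAR
    obtain ⟨T, hTm, -, hT⟩ := hU.preattractor.2
    exact ⟨RandomDynamics.recurrentSet θ T, RandomDynamics.entranceFunction γ φ U,
      RandomDynamics.measurableSet_recurrentSet hTm,
      RandomDynamics.measure_compl_recurrentSet hTm,
      RandomDynamics.preimage_shift_recurrentSet T, fun h => absurd h hfwd,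
      hmeas hU.preattractor, fun ω hω => hU.entranceFunction_spec
        (RandomDynamics.visitsPersist_of_mem_recurrentSet hT hω)⟩
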